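/- For every triple $(r,s,t)$ of positive integers, let $\Delta^+(r,s,t)=\langle x,y\mid x^r=y^s=(xy)^t=1\rangle$ be the ordinary triangle group, and let $\mathcal{Q}(r,s,t)$ be the set of orders of its finite quotients, that is, the set of all positive integers $n$ such that $\Delta^+(r,s,t)$ has a quotient group of order $n$. Then $\mathcal{Q}(r,s,t)$ has natural density zero: the limit $$\lim_{x\to\infty}\frac{|\mathcal{Q}(r,s,t)\cap\{1,\dots,x\}|}{x}$$ exists and equals $0$. -/

import Mathlib

/-- The relators `x ^ r`, `y ^ s`, `(x * y) ^ t` in the free group on the two generators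
`x = FreeGroup.of 0` and `y = FreeGroup.of 1`. -/
def triangleRels (r s t : ℕ) : Set (FreeGroup (Fin 2)) :=
  {FreeGroup.of 0 ^ r, FreeGroup.of 1 ^ s, (FreeGroup.of 0 * FreeGroup.of 1) ^ t}

/-- The ordinary triangle group `⟨x, y | x ^ r = y ^ s = (x * y) ^ t = 1⟩`. -/
abbrev OrdinaryTriangleGroup (r s t : ℕ) : Type :=
  PresentedGroup (triangleRels r s t)

/-- The set of orders of the finite quotients of a group `G`. -/
def finiteQuotientOrders (G : Type*) [Group G] : Set ℕ :=
  {n | ∃ N : Subgroup G, N.Normal ∧ Finite (G ⧸ N) ∧ Nat.card (G ⧸ N) = n}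

/-- The set `S` of natural numbers has natural density `d`: the limit of
`|S ∩ {1, …, x}| / x`, as `x` tends to infinity, exists and equals `d`. -/
def HasNaturalDensity (S : Set ℕ) (d : ℝ) : Prop :=
  Filter.Tendsto (fun x : ℕ => ((S ∩ Set.Icc 1 x).ncard : ℝ) / (x : ℝ)) Filter.atTop (nhds d)

/-!
# Orders of finite quotients of triangle groups have natural density zero

Let `G`, of order `n`, be a quotient of the triangle group, generated by `x` and `y`. Suppose that
a prime `p > r, s, t` with `p ≡ -1` modulo `r * s` divides `n`. Then either `p ^ 2 ∣ n` or
`p * d ∣ n` for some `d ≠ 1` with `d ≡ 1` modulo `p` (`exists_dvd_of_mem_finiteQuotientOrders`).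
Otherwise Sylow's theorem makes the Sylow `p`-subgroup `P` normal, of order `p`. Conjugation maps `G` to
`Aut P`, which is cyclic of order `p - 1`; since `r` and `s` divide `p + 1`, the images of `x` and
`y` have order at most two, so one of `x`, `y`, `x * y` centralizes `P`. If `H` is a complement of `P`,
then `K = H ∩ C(P)` is normal in `G`, of index divisible by `p`, and contains each element of `C(P)`
whose order is coprime to `p`. Hence one of `x`, `y`, `x * y` is in `K`, and `G / K` is cyclic of
order dividing `r` or `s`, contradicting `p ∣ [G : K]`.

It remains to see that almost all `n` are divisible by such a prime and violate the alternative.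
Restrict to primes `p > z = (log x) ^ 2` for `n ≤ x`. The alternative then holds for at most
`x * (2 + log x) / z = o(x)` of the `n` (`card_filter_exists_dvd_le`). By Turán's second moment
argument, at most `3 * x / S` of the `n` have no prime factor in a set of primes with reciprocal
sum `S` (`card_filter_not_dvd_mul_le`). Finally, the sum of `1 / p` over the primes
`z < p ≤ x` in the residue class is unbounded: the pole at `1` of the Dirichlet series of the
von Mangoldt function on the class shows that each interval `(Y, Y ^ 72]` contributes at least a
fixed positive amount (`exists_le_sum_inv_primes_block`), and the number of such consecutive
intervals that fit between `(log x) ^ 2` and `x` tends to infinity.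
-/

/-! ### Groups with a normal Sylow subgroup of prime order -/

theorem Subgroup.index_dvd_of_closure_pair_eq_top {G : Type*} [Group G] {a b : G}
    (hab : Subgroup.closure {a, b} = ⊤) {K : Subgroup G} [K.Normal] (ha : a ∈ K) {k : ℕ}
    (hb : b ^ k = 1) : K.index ∣ k := by
  have hsup : K ⊔ Subgroup.zpowers b = ⊤ := by
    rw [eq_top_iff, ← hab, Subgroup.closure_le]
    rintro g (rfl | rfl)
    · exact Subgroup.mem_sup_left ha
    · exact Subgroup.mem_sup_right (Subgroup.mem_zpowers g)
  have h : K.relIndex (Subgroup.zpowers b) = K.index := by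
    rw [← Subgroup.relIndex_sup_left, hsup, Subgroup.relIndex_top_right]
  rw [← h]
  refine (Subgroup.relIndex_dvd_card _ _).trans ?_
  rw [Nat.card_zpowers]
  exact orderOf_dvd_of_pow_eq_one hb

/-- If `H` is a Schur–Zassenhaus complement of `P`, then `K = H ⊓ C(P)` works: it is normalized by
`H` and centralized by `P`, and its index is a multiple of `H.index = p`. -/
theorem Subgroup.exists_normal_of_prime_card {G : Type*} [Group G] [Finite G] {p : ℕ}
    (hp : p.Prime) (P : Subgroup G) [P.Normal] (hP : Nat.card P = p)
    (hcop : (Nat.card P).Coprime P.index) :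
    ∃ K : Subgroup G, K.Normal ∧ p ∣ K.index ∧
      ∀ g ∈ Subgroup.centralizer (P : Set G), ∀ k : ℕ, p.Coprime k → g ^ k = 1 → g ∈ K := by
  obtain ⟨H, hH⟩ := Subgroup.exists_right_complement'_of_coprime hcop
  have hdec : ∀ g : G, ∃ u ∈ P, ∃ h ∈ H, g = u * h := by
    intro g
    obtain ⟨u, hu, h, hh, e⟩ := Subgroup.mem_sup_of_normal_left.1
      (show g ∈ P ⊔ H by rw [hH.sup_eq_top]; trivial)
    exact ⟨u, hu, h, hh, e.symm⟩
  have hcent : ∀ {c : G}, c ∈ Subgroup.centralizer (P : Set G) → ∀ u ∈ P, u * c = c * u :=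
    fun hc u hu => Subgroup.mem_centralizer_iff.1 hc u hu
  have hPcent : P ≤ Subgroup.centralizer (P : Set G) := by
    have : Fact p.Prime := ⟨hp⟩
    have : IsCyclic P := isCyclic_of_prime_card hP
    intro u hu
    refine Subgroup.mem_centralizer_iff.2 fun v hv => ?_
    let _ := IsCyclic.commGroup (α := P)
    exact congrArg Subtype.val (mul_comm (⟨v, hv⟩ : P) ⟨u, hu⟩)
  refine ⟨H ⊓ Subgroup.centralizer (P : Set G), ⟨?_⟩, ?_, ?_⟩
  · rintro k ⟨hk, hkc⟩ g
    obtain ⟨u, hu, h, hh, rfl⟩ := hdec g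
    have hC : h * k * h⁻¹ ∈ Subgroup.centralizer (P : Set G) :=
      Subgroup.Normal.conj_mem inferInstance k hkc h
    have e : u * h * k * (u * h)⁻¹ = h * k * h⁻¹ := by
      calc u * h * k * (u * h)⁻¹ = u * (h * k * h⁻¹) * u⁻¹ := by group
        _ = h * k * h⁻¹ := by rw [hcent hC u hu]; group
    rw [e]
    exact ⟨H.mul_mem (H.mul_mem hh hk) (H.inv_mem hh), hC⟩
  · have : H.index = p := by rw [hH.index_eq_card, hP]
    rw [← this]
    exact Subgroup.index_dvd_of_le inf_le_left
  · intro g hg k hk hgk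
    obtain ⟨u, hu, h, hh, rfl⟩ := hdec g
    have hhC : h ∈ Subgroup.centralizer (P : Set G) := by
      simpa using Subgroup.mul_mem _ (Subgroup.inv_mem _ (hPcent hu)) hg
    have hcomm : Commute u h := hcent hhC u hu
    have huk : u ^ k = 1 := by
      rw [hcomm.mul_pow] at hgk
      have h1 : u ^ k ∈ P ⊓ H :=
        ⟨P.pow_mem hu k, by rw [eq_inv_of_mul_eq_one_left hgk]; exact H.inv_mem (H.pow_mem hh k)⟩
      rw [hH.disjoint.eq_bot] at h1
      exact h1
    have hup : u ^ p = 1 := by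
      have := pow_card_eq_one' (x := (⟨u, hu⟩ : P))
      rw [hP] at this
      exact congrArg Subtype.val this
    have hu1 : u = 1 := by
      rw [← orderOf_eq_one_iff, ← Nat.dvd_one, ← hk]
      exact Nat.dvd_gcd (orderOf_dvd_of_pow_eq_one hup) (orderOf_dvd_of_pow_eq_one huk)
    rw [hu1, one_mul]
    exact ⟨hh, hhC⟩

/-- The automorphism group of a group of prime order is isomorphic to `(ZMod p)ˣ`, where only `±1`
square to `1`; `ι` is inversion. -/
theorem MulAut.eq_one_or_eq_of_sq_eq_one {P : Type*} [Group P] {p : ℕ} (hp : p.Prime)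
    (hP : Nat.card P = p) :
    ∃ ι : MulAut P, ∀ a : MulAut P, a ^ 2 = 1 → a = 1 ∨ a = ι := by
  have : Fact p.Prime := ⟨hp⟩
  have : IsCyclic P := isCyclic_of_prime_card hP
  subst hP
  refine ⟨(IsCyclic.mulAutMulEquiv P).symm (-1), fun a ha => ?_⟩
  have h : (IsCyclic.mulAutMulEquiv P a) ^ 2 = 1 := by rw [← map_pow, ha, map_one]
  have h' : (IsCyclic.mulAutMulEquiv P a : ZMod (Nat.card P)) ^ 2 = 1 := by
    rw [← Units.val_pow_eq_pow_val, h, Units.val_one]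
  rcases sq_eq_one_iff.1 h' with h | h
  · left
    exact (IsCyclic.mulAutMulEquiv P).injective (by rw [map_one]; exact Units.ext h)
  · right
    rw [MulEquiv.eq_symm_apply]
    exact Units.ext h

theorem MulAut.pow_card_sub_one {P : Type*} [Group P] {p : ℕ} (hp : p.Prime)
    (hP : Nat.card P = p) (a : MulAut P) : a ^ (p - 1) = 1 := by
  have : Fact p.Prime := ⟨hp⟩
  have : IsCyclic P := isCyclic_of_prime_card hP
  have : Finite P := Nat.finite_of_card_ne_zero (hP ▸ hp.ne_zero)
  have h := pow_card_eq_one' (x := a)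
  rwa [IsCyclic.card_mulAut, hP, Nat.totient_prime hp] at h

/-- The number of Sylow `p`-subgroups is a value of `d` as in the hypothesis. -/
theorem Sylow.normal_of_forall_dvd {G : Type*} [Group G] [Finite G] {p : ℕ} [Fact p.Prime]
    (P : Sylow p G) (hP : Nat.card P = p)
    (hd : ∀ d, p * d ∣ Nat.card G → d ≡ 1 [MOD p] → d = 1) :
    (P : Subgroup G).Normal := by
  have h1 : Nat.card (Sylow p G) = 1 := by
    refine hd _ ?_ (card_sylow_modEq_one p G)
    rw [← Subgroup.card_mul_index (P : Subgroup G)]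
    exact mul_dvd_mul (dvd_of_eq hP.symm) P.card_dvd_index
  have := (Nat.card_eq_one_iff_unique.1 h1).1
  infer_instance

/-- A finite group satisfying the relations of a triangle group is not generated by `x` and `y` if a
suitable prime `p` forces it to have a normal Sylow subgroup of order `p`. -/
theorem not_closure_pair_eq_top {G : Type*} [Group G] [Finite G] {p r s t : ℕ} (hp : p.Prime)
    (hr0 : 0 < r) (hs0 : 0 < s) (ht0 : 0 < t)
    (hr : r < p) (hs : s < p) (ht : t < p) (hrp : r ∣ p + 1) (hsp : s ∣ p + 1)
    (hpG : p ∣ Nat.card G) (hppG : ¬ p * p ∣ Nat.card G)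
    (hd : ∀ d, p * d ∣ Nat.card G → d ≡ 1 [MOD p] → d = 1)
    {x y : G} (hx : x ^ r = 1) (hy : y ^ s = 1) (hxy : (x * y) ^ t = 1) :
    Subgroup.closure {x, y} ≠ ⊤ := by
  intro htop
  have : Fact p.Prime := ⟨hp⟩
  have hcopr : ∀ {k}, 0 < k → k < p → p.Coprime k := fun h0 h =>
    Nat.coprime_of_lt_prime h0.ne' h hp
  obtain ⟨P⟩ : Nonempty (Sylow p G) := inferInstance
  have hP : Nat.card P = p := by
    have h1 := P.card_eq_multiplicity
    have hf : (Nat.card G).factorization p = 1 := by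
      apply le_antisymm
      · by_contra! h
        exact hppG (by
          rw [← sq]
          exact (hp.pow_dvd_iff_le_factorization Nat.card_pos.ne').2 h)
      · exact (hp.dvd_iff_one_le_factorization Nat.card_pos.ne').1 hpG
    rwa [hf, pow_one] at h1
  have : (P : Subgroup G).Normal := P.normal_of_forall_dvd hP hd
  obtain ⟨K, hK, hKp, hKmem⟩ :=
    Subgroup.exists_normal_of_prime_card hp (P : Subgroup G) hP P.card_coprime_index
  let χ : G →* MulAut (P : Subgroup G) := MulAut.conjNormal
  have hker : ∀ g, χ g = 1 → g ∈ Subgroup.centralizer ((P : Subgroup G) : Set G) := by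
    intro g hg
    refine Subgroup.mem_centralizer_iff.2 fun u hu => ?_
    have h1 : (χ g ⟨u, hu⟩ : G) = u := by rw [hg]; rfl
    have h2 : (χ g ⟨u, hu⟩ : G) = g * u * g⁻¹ := MulAut.conjNormal_apply g ⟨u, hu⟩
    rw [h2] at h1
    exact (mul_inv_eq_iff_eq_mul.1 h1).symm
  -- The order of `χ g` divides both `p + 1` and `p - 1`, hence divides `2`.
  have hsq : ∀ {g : G} {k : ℕ}, k ∣ p + 1 → g ^ k = 1 → χ g ^ 2 = 1 := by
    intro g k hk hg
    have h1 : orderOf (χ g) ∣ p + 1 :=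
      (orderOf_dvd_of_pow_eq_one (by rw [← map_pow, hg, map_one])).trans hk
    have h2 : orderOf (χ g) ∣ p - 1 :=
      orderOf_dvd_of_pow_eq_one (MulAut.pow_card_sub_one hp hP (χ g))
    have h3 := Nat.dvd_sub h1 h2
    rw [show p + 1 - (p - 1) = 2 by have := hp.two_le; omega] at h3
    exact orderOf_dvd_iff_pow_eq_one.1 h3
  have hnot : ∀ {a b : G} {k : ℕ}, 0 < k → k < p → Subgroup.closure {a, b} = ⊤ → a ∈ K →
      b ^ k = 1 → False := fun h0 hk hab ha hb =>
    Nat.not_dvd_of_pos_of_lt h0 hk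
      (hKp.trans (Subgroup.index_dvd_of_closure_pair_eq_top hab ha hb))
  obtain ⟨ι, hι⟩ := MulAut.eq_one_or_eq_of_sq_eq_one (P := (P : Subgroup G)) hp hP
  rcases hι _ (hsq hrp hx) with h1 | h1
  · exact hnot hs0 hs htop (hKmem x (hker x h1) r (hcopr hr0 hr) hx) hy
  rcases hι _ (hsq hsp hy) with h2 | h2
  · exact hnot hr0 hr (by rwa [Set.pair_comm]) (hKmem y (hker y h2) s (hcopr hs0 hs) hy) hx
  -- Neither `x` nor `y` centralizes `P`, so both act by inversion and `x * y` acts trivially.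
  have h3 : χ (x * y) = 1 := by
    rw [map_mul, h2, ← h1, ← sq, hsq hrp hx]
  refine hnot (a := x * y) hr0 hr ?_ (hKmem _ (hker _ h3) t (hcopr ht0 ht) hxy) hx
  rw [eq_top_iff, ← htop, Subgroup.closure_le]
  have hxm : x ∈ Subgroup.closure {x * y, x} := Subgroup.subset_closure (by simp)
  have hxym : x * y ∈ Subgroup.closure {x * y, x} := Subgroup.subset_closure (by simp)
  rintro g (rfl | rfl)
  · exact hxm
  · simpa using Subgroup.mul_mem _ (Subgroup.inv_mem _ hxm) hxym

/-- The arithmetic restriction on the orders of finite quotients from which the density statement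
follows. -/
theorem exists_dvd_of_mem_finiteQuotientOrders {r s t n p : ℕ}
    (hr0 : 0 < r) (hs0 : 0 < s) (ht0 : 0 < t)
    (hn : n ∈ finiteQuotientOrders (OrdinaryTriangleGroup r s t)) (hp : p.Prime)
    (hr : r < p) (hs : s < p) (ht : t < p) (hrp : r ∣ p + 1) (hsp : s ∣ p + 1) (hpn : p ∣ n) :
    p * p ∣ n ∨ ∃ d, p * d ∣ n ∧ d ≡ 1 [MOD p] ∧ d ≠ 1 := by
  obtain ⟨N, hN, hfin, rfl⟩ := hn
  by_contra! hcon
  obtain ⟨hpp, hd⟩ := hcon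
  have hrel : ∀ w ∈ triangleRels r s t,
      QuotientGroup.mk' N (PresentedGroup.mk (triangleRels r s t) w) = 1 := fun w hw => by
    rw [PresentedGroup.one_of_mem hw, map_one]
  let x := QuotientGroup.mk' N (PresentedGroup.of (rels := triangleRels r s t) 0)
  let y := QuotientGroup.mk' N (PresentedGroup.of (rels := triangleRels r s t) 1)
  have hx : x ^ r = 1 := 
    hrel (FreeGroup.of 0 ^ r) (by simp [triangleRels])
  have hy : y ^ s = 1 := 
    hrel (FreeGroup.of 1 ^ s) (by simp [triangleRels])
  have hxy : (x * y) ^ t = 1 := 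
    hrel ((FreeGroup.of 0 * FreeGroup.of 1) ^ t) (by simp [triangleRels])
  refine not_closure_pair_eq_top hp hr0 hs0 ht0 hr hs ht hrp hsp hpn hpp hd hx hy hxy ?_
  have h := congrArg (Subgroup.map (QuotientGroup.mk' N))
    (PresentedGroup.closure_range_of (triangleRels r s t))
  rw [MonoidHom.map_closure, Subgroup.map_top_of_surjective _ (QuotientGroup.mk'_surjective N)] at h
  rw [← h]
  congr 1
  ext g
  simp [x, y, Fin.exists_fin_two, eq_comm]

/-! ### Reciprocal sums of primes in a residue class -/

/-- The primes `p` in the half-open interval `(Y, X]` whose residue modulo `q` is `a`. -/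
def primesInResidueClass {q : ℕ} (a : ZMod q) (Y X : ℕ) : Finset ℕ :=
  (Finset.Ioc Y X).filter fun p : ℕ => p.Prime ∧ (p : ZMod q) = a

open ArithmeticFunction.vonMangoldt in
/-- The Dirichlet series of the von Mangoldt function restricted to an invertible residue class has
a simple pole at `1` with residue `1 / φ(q)`; this is the two-sided version of
`ArithmeticFunction.vonMangoldt.LSeries_residueClass_lower_bound`. -/
theorem ArithmeticFunction.vonMangoldt.exists_abs_tsum_residueClass_sub_le {q : ℕ} [NeZero q]
    {a : ZMod q} (ha : IsUnit a) :
    ∃ C : ℝ, ∀ σ ∈ Set.Ioc (0 : ℝ) 1,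
      |∑' n : ℕ, residueClass a n / (n : ℝ) ^ (1 + σ) - (q.totient : ℝ)⁻¹ / σ| ≤ C := by
  have hcont : ContinuousOn (fun x : ℝ ↦ (LFunctionResidueClassAux a x).re) (Set.Icc 1 2) :=
    Complex.continuous_re.continuousOn.comp (t := Set.univ)
      (continuousOn_LFunctionResidueClassAux a) (fun _ _ ↦ trivial)
      |>.comp Complex.continuous_ofReal.continuousOn fun x hx ↦ by
        simpa only [Set.mem_ofPred_eq, Complex.ofReal_re] using hx.1
  obtain ⟨C, hC⟩ := isCompact_Icc.exists_bound_of_continuousOn hcont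
  refine ⟨C, fun σ hσ => ?_⟩
  have hx : (1 : ℝ) < 1 + σ := by linarith [hσ.1]
  have key : ∑' n : ℕ, residueClass a n / (n : ℝ) ^ (1 + σ) - (q.totient : ℝ)⁻¹ / σ =
      (LFunctionResidueClassAux a ((1 + σ : ℝ) : ℂ)).re := by
    refine Complex.ofReal_injective ?_
    rw [← LFunctionResidueClassAux_real ha hx,
      eqOn_LFunctionResidueClassAux ha
        (Set.mem_ofPred.mpr ((Complex.ofReal_re (1 + σ)).symm ▸ hx))]
    simp only [Complex.ofReal_sub, Complex.ofReal_tsum, Complex.ofReal_div,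
      Complex.ofReal_cpow (Nat.cast_nonneg _), Complex.ofReal_natCast, Complex.ofReal_inv,
      Complex.ofReal_add, Complex.ofReal_one, add_sub_cancel_left, LSeries, LSeries.term]
    congr 1
    refine tsum_congr fun n ↦ ?_
    split_ifs with hn
    · simp only [hn, residueClass_apply_zero, Complex.ofReal_zero, zero_div]
    · rfl
  rw [key, ← Real.norm_eq_abs]
  exact hC _ ⟨hx.le, by linarith [hσ.2]⟩

/-- For `n ≤ Y` the factor `n ^ (1 / log Y)` is at most `e < 3`, so the head of a Dirichlet series
is controlled by its value at `1 + 1 / log Y`. -/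
theorem sum_range_div_rpow_le {f : ℕ → ℝ} (hf : ∀ n, 0 ≤ f n) (hf0 : f 0 = 0) {Y : ℕ}
    (hY : 3 ≤ Y) {σ : ℝ} (hσ : 0 ≤ σ)
    (hs : Summable fun n : ℕ => f n / (n : ℝ) ^ (1 + 1 / Real.log Y)) :
    ∑ n ∈ Finset.range (Y + 1), f n / (n : ℝ) ^ (1 + σ) ≤
      3 * ∑' n : ℕ, f n / (n : ℝ) ^ (1 + 1 / Real.log Y) := by
  have hY3 : (3 : ℝ) ≤ Y := by exact_mod_cast hY
  have hlog : 0 < Real.log Y := Real.log_pos (by linarith)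
  have hterm : ∀ n ∈ Finset.range (Y + 1),
      f n / (n : ℝ) ^ (1 + σ) ≤ 3 * (f n / (n : ℝ) ^ (1 + 1 / Real.log Y)) := by
    intro n hn
    rcases Nat.eq_zero_or_pos n with rfl | hn0
    · simp [hf0]
    have hn0' : (0 : ℝ) < n := by exact_mod_cast hn0
    have hnY : (n : ℝ) ≤ Y := by exact_mod_cast Nat.lt_succ_iff.1 (Finset.mem_range.1 hn)
    rw [← mul_div_assoc, div_le_div_iff₀ (Real.rpow_pos_of_pos hn0' _)
      (Real.rpow_pos_of_pos hn0' _), mul_comm (3 : ℝ), mul_assoc]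
    refine mul_le_mul_of_nonneg_left ?_ (hf n)
    have h1 : (n : ℝ) ^ (1 / Real.log Y) ≤ 3 := by
      calc (n : ℝ) ^ (1 / Real.log Y) ≤ (Y : ℝ) ^ (1 / Real.log Y) := by gcongr
        _ = Real.exp 1 := by
          rw [Real.rpow_def_of_pos (by linarith), mul_one_div_cancel hlog.ne']
        _ ≤ 3 := by linarith [Real.exp_one_lt_d9]
    have h2 : (1 : ℝ) ≤ (n : ℝ) ^ σ := Real.one_le_rpow (by exact_mod_cast hn0) hσ
    rw [Real.rpow_add hn0', Real.rpow_add hn0', Real.rpow_one]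
    calc (n : ℝ) * (n : ℝ) ^ (1 / Real.log Y) ≤ n * 3 := by gcongr
      _ = 3 * (n * 1) := by ring
      _ ≤ 3 * (n * (n : ℝ) ^ σ) := by gcongr
  refine (Finset.sum_le_sum hterm).trans ?_
  rw [← Finset.mul_sum]
  exact mul_le_mul_of_nonneg_left (hs.sum_le_tsum _ fun n _ => div_nonneg (hf n) (by positivity))
    (by norm_num)

/-- Rankin's trick for the tail of a Dirichlet series. -/
theorem tsum_nat_add_div_rpow_le {f : ℕ → ℝ} (hf : ∀ n, 0 ≤ f n) {X : ℕ} (hX : 0 < X)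
    {σ : ℝ} (hσ : 0 ≤ σ) (hs : Summable fun n : ℕ => f n / (n : ℝ) ^ (1 + σ))
    (hs' : Summable fun n : ℕ => f n / (n : ℝ) ^ (1 + σ / 2)) :
    ∑' n : ℕ, f (n + (X + 1)) / ((n + (X + 1) : ℕ) : ℝ) ^ (1 + σ) ≤
      ((X : ℝ) ^ (σ / 2))⁻¹ * ∑' n : ℕ, f n / (n : ℝ) ^ (1 + σ / 2) := by
  have hX0 : (0 : ℝ) < X := by exact_mod_cast hX
  have hXσ : 0 < (X : ℝ) ^ (σ / 2) := Real.rpow_pos_of_pos hX0 _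
  let g : ℕ → ℝ := fun n => f n / (n : ℝ) ^ (1 + σ)
  let g' : ℕ → ℝ := fun n => f n / (n : ℝ) ^ (1 + σ / 2)
  have hterm : ∀ n : ℕ, g (n + (X + 1)) ≤ ((X : ℝ) ^ (σ / 2))⁻¹ * g' (n + (X + 1)) := by
    intro n
    generalize hm : n + (X + 1) = m
    have hmX : (X : ℝ) ≤ m := by exact_mod_cast (by omega : X ≤ m)
    have hm0 : (0 : ℝ) < m := hX0.trans_le hmX
    have h0 : 0 ≤ f m / (m : ℝ) ^ (1 + σ / 2) := div_nonneg (hf m) (by positivity)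
    change f m / (m : ℝ) ^ (1 + σ) ≤ ((X : ℝ) ^ (σ / 2))⁻¹ * (f m / (m : ℝ) ^ (1 + σ / 2))
    rw [show 1 + σ = 1 + σ / 2 + σ / 2 by ring, Real.rpow_add hm0 (1 + σ / 2), ← div_div,
      inv_mul_eq_div]
    exact div_le_div_of_nonneg_left h0 hXσ (Real.rpow_le_rpow hX0.le hmX (by linarith))
  calc ∑' n : ℕ, g (n + (X + 1)) ≤ ∑' n : ℕ, ((X : ℝ) ^ (σ / 2))⁻¹ * g' (n + (X + 1)) :=
        Summable.tsum_le_tsum hterm ((summable_nat_add_iff (f := g) (X + 1)).2 hs)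
          (((summable_nat_add_iff (f := g') (X + 1)).2 hs').mul_left _)
    _ = ((X : ℝ) ^ (σ / 2))⁻¹ * ∑' n : ℕ, g' (n + (X + 1)) := tsum_mul_left
    _ ≤ ((X : ℝ) ^ (σ / 2))⁻¹ * ∑' n : ℕ, g' n := by
      refine mul_le_mul_of_nonneg_left ?_ (inv_nonneg.2 hXσ.le)
      rw [← Summable.sum_add_tsum_nat_add (f := g') (X + 1) hs']
      exact le_add_of_nonneg_left
        (Finset.sum_nonneg fun n _ => div_nonneg (hf n) (by positivity))

open ArithmeticFunction.vonMangoldt in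
/-- A weak form of Mertens' second theorem for a residue class `a`. Write `c = 1 / φ(q)`,
`ℓ = log Y` and evaluate the Dirichlet series of the von Mangoldt function on the class at `1 + σ`
with `σ = 1 / (12 * ℓ)`, where it is `12 * c * ℓ + O(1)`. The terms with `n ≤ Y` and those with
`n > Y ^ 72` contribute at most `3 * c * ℓ + O(1)` each, and proper prime powers `O(1)`, so
the primes in between account for at least `6 * c * ℓ - O(1)`; for each of them
`log p ≤ 72 * ℓ`. -/
theorem exists_le_sum_inv_primes_block {q : ℕ} [NeZero q] {a : ZMod q} (ha : IsUnit a) :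
    ∃ κ > (0 : ℝ), ∃ Y₀ : ℕ, ∀ Y ≥ Y₀,
      κ ≤ ∑ p ∈ primesInResidueClass a Y (Y ^ 72), (p : ℝ)⁻¹ := by
  obtain ⟨C, hC⟩ := exists_abs_tsum_residueClass_sub_le ha
  set c : ℝ := (q.totient : ℝ)⁻¹
  have hc0 : 0 < c := inv_pos.2 (mod_cast q.totient.pos_of_neZero)
  set f : ℕ → ℝ := residueClass a with hf
  have hf0 : ∀ n, 0 ≤ f n := residueClass_nonneg a
  have hC0 : 0 ≤ C := (abs_nonneg _).trans (hC 1 (by simp))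
  have hsum : ∀ {σ : ℝ}, 0 < σ → Summable fun n : ℕ => f n / (n : ℝ) ^ (1 + σ) := fun hσ =>
    LSeries.summable_real_of_abscissaOfAbsConv_lt <|
      (abscissaOfAbsConv_residueClass_le_one a).trans_lt <| by
        exact_mod_cast (by linarith : (1 : ℝ) < 1 + _)
  have hup : ∀ σ ∈ Set.Ioc (0 : ℝ) 1, ∑' n : ℕ, f n / (n : ℝ) ^ (1 + σ) ≤ c / σ + C :=
    fun σ hσ => by linarith [(abs_le.1 (hC σ hσ)).2]
  have hnp := summable_residueClass_non_primes_div a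
  set D : ℝ := ∑' n : ℕ, (if n.Prime then 0 else f n) / n
  obtain ⟨T, hT⟩ := exists_nat_gt ((5 * C + D) * 4 / c)
  refine ⟨c / 24, by positivity, max 3 ⌈Real.exp T⌉₊, fun Y hY => ?_⟩
  have hY3 : 3 ≤ Y := le_trans (le_max_left _ _) hY
  have hYT : (T : ℝ) ≤ Real.log Y := by
    rw [Real.le_log_iff_exp_le (by positivity)]
    exact (Nat.le_ceil _).trans (by exact_mod_cast le_trans (le_max_right _ _) hY)
  have hY1 : 1 ≤ Real.log Y := by
    rw [Real.le_log_iff_exp_le (by positivity)]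
    have : (3 : ℝ) ≤ Y := by exact_mod_cast hY3
    linarith [Real.exp_one_lt_d9]
  set ℓ := Real.log Y with hℓ
  set σ : ℝ := 1 / (12 * ℓ) with hσ
  have hσ0 : 0 < σ := by positivity
  have hσ1 : σ ≤ 1 / 12 := by
    rw [hσ]; exact one_div_le_one_div_of_le (by norm_num) (by linarith)
  obtain ⟨X, hX⟩ : ∃ X : ℕ, X = Y ^ 72 := ⟨_, rfl⟩
  have hYX : Y ≤ X := hX ▸ Nat.le_self_pow (by norm_num) Y
  have hlogX : Real.log X = 72 * ℓ := by rw [hX, Nat.cast_pow, Real.log_pow, ← hℓ]; norm_num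
  have hX0 : (0 : ℝ) < X := by exact_mod_cast (by omega : 0 < X)
  rw [← hX]
  have hhead : ∑ n ∈ Finset.range (Y + 1), f n / (n : ℝ) ^ (1 + σ) ≤ 3 * (c * ℓ + C) := by
    have hτ : (1 / ℓ) ∈ Set.Ioc (0 : ℝ) 1 := ⟨by positivity, by
      rw [div_le_one (by linarith)]; exact hY1⟩
    have h1 := hup _ hτ
    rw [div_div_eq_mul_div, div_one] at h1
    have h2 := sum_range_div_rpow_le hf0 (residueClass_apply_zero a) hY3 hσ0.le (hsum hτ.1)
    linarith
  have htail : ∑' n : ℕ, f (n + (X + 1)) / ((n + (X + 1) : ℕ) : ℝ) ^ (1 + σ)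
      ≤ (1 / 8) * (24 * c * ℓ + C) := by
    have hτ : σ / 2 ∈ Set.Ioc (0 : ℝ) 1 := ⟨by positivity, by linarith⟩
    have h1 := hup _ hτ
    have h2 : c / (σ / 2) = 24 * c * ℓ := by rw [hσ]; field_simp; norm_num
    rw [h2] at h1
    refine (tsum_nat_add_div_rpow_le hf0 (by omega) hσ0.le (hsum hσ0) (hsum hτ.1)).trans ?_
    have h3 : (X : ℝ) ^ (σ / 2) = Real.exp 1 ^ 3 := by
      rw [Real.rpow_def_of_pos hX0, ← Real.exp_nat_mul, hlogX, hσ]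
      congr 1
      field_simp
      norm_num
    have h4 : (8 : ℝ) ≤ Real.exp 1 ^ 3 := by
      have : (2 : ℝ) ≤ Real.exp 1 := by linarith [Real.exp_one_gt_d9]
      calc (8 : ℝ) = 2 ^ 3 := by norm_num
        _ ≤ _ := by gcongr
    rw [h3]
    refine mul_le_mul ?_ h1 (tsum_nonneg fun n => div_nonneg (hf0 n) (by positivity)) (by norm_num)
    rw [inv_eq_one_div]
    exact one_div_le_one_div_of_le (by norm_num) h4
  have hmid : ∑ n ∈ Finset.Ioc Y X, f n / (n : ℝ) ^ (1 + σ) ≤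
      D + 72 * ℓ * ∑ p ∈ primesInResidueClass a Y X, (p : ℝ)⁻¹ := by
    have hle : ∀ n ∈ Finset.Ioc Y X, f n / (n : ℝ) ^ (1 + σ) ≤
        (if n.Prime then 0 else f n) / n +
          72 * ℓ * (if n.Prime ∧ (n : ZMod q) = a then (n : ℝ)⁻¹ else 0) := by
      intro n hn
      obtain ⟨hYn, hnX⟩ := Finset.mem_Ioc.1 hn
      have hn1 : (1 : ℝ) ≤ n := by exact_mod_cast (by omega : 1 ≤ n)
      have h1 : f n / (n : ℝ) ^ (1 + σ) ≤ f n / n := by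
        refine div_le_div_of_nonneg_left (hf0 n) (by linarith) ?_
        calc (n : ℝ) = (n : ℝ) ^ (1 : ℝ) := (Real.rpow_one _).symm
          _ ≤ _ := Real.rpow_le_rpow_of_exponent_le hn1 (by linarith)
      refine h1.trans ?_
      by_cases hpr : n.Prime
      · by_cases hna : (n : ZMod q) = a
        · have h2 : f n = Real.log n := by
            rw [hf]
            simp [residueClass, hna, ArithmeticFunction.vonMangoldt_apply_prime hpr]
          have h3 : Real.log n ≤ 72 * ℓ := by
            rw [← hlogX]
            exact Real.log_le_log (by linarith) (by exact_mod_cast hnX)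
          rw [if_pos hpr, if_pos ⟨hpr, hna⟩, zero_div, zero_add, h2, div_eq_mul_inv]
          exact mul_le_mul_of_nonneg_right h3 (by positivity)
        · have h2 : f n = 0 := by simp [hf, residueClass, hna]
          simp [hpr, hna, h2]
      · simp [hpr]
    refine (Finset.sum_le_sum hle).trans ?_
    rw [Finset.sum_add_distrib, ← Finset.mul_sum, ← Finset.sum_filter, primesInResidueClass]
    gcongr
    exact hnp.sum_le_tsum _ fun n _ => by
      split_ifs
      · simp
      · exact div_nonneg (hf0 n) (Nat.cast_nonneg n)
  have hlow : 12 * c * ℓ - C ≤ ∑' n : ℕ, f n / (n : ℝ) ^ (1 + σ) := by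
    have h1 := (abs_le.1 (hC σ ⟨hσ0, by linarith⟩)).1
    have h2 : c / σ = 12 * c * ℓ := by rw [hσ]; field_simp
    rw [h2] at h1
    linarith
  have hsplit : ∑' n : ℕ, f n / (n : ℝ) ^ (1 + σ) =
      ∑ n ∈ Finset.range (Y + 1), f n / (n : ℝ) ^ (1 + σ) +
      ∑ n ∈ Finset.Ioc Y X, f n / (n : ℝ) ^ (1 + σ) +
      ∑' n : ℕ, f (n + (X + 1)) / ((n + (X + 1) : ℕ) : ℝ) ^ (1 + σ) := by
    rw [← (hsum hσ0).sum_add_tsum_nat_add (X + 1)]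
    congr 1
    rw [← Finset.sum_range_add_sum_Ico _ (by omega : Y + 1 ≤ X + 1)]
    congr 1
    exact Finset.sum_congr (by ext n; simp only [Finset.mem_Ico, Finset.mem_Ioc]; omega)
      fun _ _ => rfl
  have hTc : (5 * C + D) * 4 < c * ℓ := by
    have h1 : (5 * C + D) * 4 / c < ℓ := hT.trans_le hYT
    rw [div_lt_iff₀ hc0] at h1
    linarith
  set S := ∑ p ∈ primesInResidueClass a Y X, (p : ℝ)⁻¹ with hS
  -- `12cℓ - C ≤ (3cℓ + 3C) + (D + 72ℓS) + (3cℓ + C / 8)`, and the constants are absorbed by `3cℓ`.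
  have hfin : c * 3 * ℓ ≤ 72 * S * ℓ := by nlinarith
  have := le_of_mul_le_mul_right hfin (by linarith)
  linarith

/-- Summing the block estimate over the consecutive intervals from `Y ^ 72 ^ i` to
`Y ^ 72 ^ (i + 1)`. -/
theorem exists_le_sum_inv_primes {q : ℕ} [NeZero q] {a : ZMod q} (ha : IsUnit a) (A : ℝ) :
    ∃ m Y₀ : ℕ, ∀ Y ≥ Y₀,
      A ≤ ∑ p ∈ primesInResidueClass a Y (Y ^ m), (p : ℝ)⁻¹ := by
  obtain ⟨κ, hκ, Y₁, hblock⟩ := exists_le_sum_inv_primes_block ha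
  have key : ∀ k : ℕ, ∀ Y ≥ max Y₁ 1,
      k * κ ≤ ∑ p ∈ primesInResidueClass a Y (Y ^ 72 ^ k), (p : ℝ)⁻¹ := by
    intro k
    induction k with
    | zero => intro Y _; simp [primesInResidueClass]
    | succ k ih =>
      intro Y hY
      have hle : Y ≤ Y ^ 72 ^ k := Nat.le_self_pow (by positivity) Y
      have hle2 : Y ^ 72 ^ k ≤ Y ^ 72 ^ (k + 1) := by
        rw [pow_succ 72, pow_mul]
        exact Nat.le_self_pow (by norm_num) _
      have h1 := ih Y hY
      have h2 := hblock (Y ^ 72 ^ k) (((le_max_left _ _).trans hY).trans hle)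
      rw [← pow_mul, ← pow_succ] at h2
      rw [primesInResidueClass, ← Finset.Ioc_union_Ioc_eq_Ioc hle hle2, Finset.filter_union,
        Finset.sum_union]
      · rw [primesInResidueClass] at h1 h2
        push_cast
        linarith
      · exact Finset.disjoint_filter_filter (Finset.Ioc_disjoint_Ioc_of_le le_rfl)
  obtain ⟨k, hk⟩ := exists_nat_ge (A / κ)
  refine ⟨72 ^ k, max Y₁ 1, fun Y hY => le_trans ?_ (key k Y hY)⟩
  rwa [div_le_iff₀ hκ] at hk

/-! ### Counting integers by their divisors -/

theorem Nat.cast_card_filter_dvd_le (x d : ℕ) :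
    (((Finset.Ioc 0 x).filter (d ∣ ·)).card : ℝ) ≤ x / d := by
  rw [Nat.Ioc_filter_dvd_card_eq_div]
  exact Nat.cast_div_le

/-- Turán's second moment argument: the number `ω n` of divisors of `n` in `T` has mean about
`S = ∑ p ∈ T, 1 / p` and variance about `S` on `1, …, x`, so it rarely vanishes when `S` is
large. -/
theorem card_filter_not_dvd_mul_le (x : ℕ) (T : Finset ℕ) (hprime : ∀ p ∈ T, p.Prime)
    (hcard : T.card ≤ x) :
    (((Finset.Ioc 0 x).filter fun n => ∀ p ∈ T, ¬ p ∣ n).card : ℝ) * ∑ p ∈ T, (p : ℝ)⁻¹ ≤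
      3 * x := by
  set S : ℝ := ∑ p ∈ T, (p : ℝ)⁻¹ with hS
  have hS0 : 0 ≤ S := Finset.sum_nonneg fun p _ => by positivity
  rcases hS0.eq_or_lt with h0 | hSpos
  · rw [← h0, mul_zero]; positivity
  have hx0 : (0 : ℝ) ≤ x := Nat.cast_nonneg x
  let ω : ℕ → ℝ := fun n => ∑ p ∈ T, if p ∣ n then 1 else 0
  have hcount : ∀ d : ℕ, ∑ n ∈ Finset.Ioc 0 x, (if d ∣ n then (1 : ℝ) else 0) =
      ((x / d : ℕ) : ℝ) := fun d => by
    rw [Finset.sum_boole, Nat.Ioc_filter_dvd_card_eq_div]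
  have hfirst : x * S - x ≤ ∑ n ∈ Finset.Ioc 0 x, ω n := by
    rw [Finset.sum_comm]
    simp only [hcount]
    have h1 : ∑ p ∈ T, ((x : ℝ) * (p : ℝ)⁻¹ - 1) ≤ ∑ p ∈ T, ((x / p : ℕ) : ℝ) := by
      refine Finset.sum_le_sum fun p hp => ?_
      rw [← div_eq_mul_inv]
      have := Nat.lt_floor_add_one ((x : ℝ) / p)
      rw [Nat.floor_div_eq_div] at this
      linarith
    rw [Finset.sum_sub_distrib, ← Finset.mul_sum, ← hS, Finset.sum_const, nsmul_eq_mul,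
      mul_one] at h1
    have : (T.card : ℝ) ≤ x := by exact_mod_cast hcard
    linarith
  -- Distinct primes `p`, `l` contribute at most `x / (p * l)`, the diagonal at most `x / p`.
  have hsecond : ∑ n ∈ Finset.Ioc 0 x, ω n ^ 2 ≤ x * S ^ 2 + x * S := by
    have h1 : ∀ n, ω n ^ 2 = ∑ p ∈ T, ∑ l ∈ T, if p ∣ n ∧ l ∣ n then (1 : ℝ) else 0 := by
      intro n
      rw [sq, Finset.sum_mul_sum]
      refine Finset.sum_congr rfl fun p _ => Finset.sum_congr rfl fun l _ => ?_
      by_cases h : p ∣ n <;> by_cases h' : l ∣ n <;> simp [h, h']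
    have h2 : ∀ p ∈ T, ∀ l ∈ T,
        ∑ n ∈ Finset.Ioc 0 x, (if p ∣ n ∧ l ∣ n then (1 : ℝ) else 0) ≤
          x * ((p : ℝ)⁻¹ * (l : ℝ)⁻¹) + if p = l then x * (p : ℝ)⁻¹ else 0 := by
      intro p hp l hl
      by_cases hpl : p = l
      · subst hpl
        simp only [and_self, if_true, hcount]
        have h3 : ((x / p : ℕ) : ℝ) ≤ x * (p : ℝ)⁻¹ := by
          rw [← div_eq_mul_inv]; exact Nat.cast_div_le
        have : 0 ≤ (x : ℝ) * ((p : ℝ)⁻¹ * (p : ℝ)⁻¹) := by positivity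
        linarith
      · have hcop : p.Coprime l := (Nat.coprime_primes (hprime p hp) (hprime l hl)).2 hpl
        have h3 : ∀ n, (p ∣ n ∧ l ∣ n) ↔ p * l ∣ n := fun n =>
          ⟨fun h => hcop.mul_dvd_of_dvd_of_dvd h.1 h.2,
            fun h => ⟨(dvd_mul_right p l).trans h, (dvd_mul_left l p).trans h⟩⟩
        simp only [h3, hcount, if_neg hpl, add_zero]
        refine Nat.cast_div_le.trans (le_of_eq ?_)
        push_cast
        rw [div_eq_mul_inv, mul_inv]
    calc ∑ n ∈ Finset.Ioc 0 x, ω n ^ 2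
        = ∑ p ∈ T, ∑ l ∈ T, ∑ n ∈ Finset.Ioc 0 x,
            (if p ∣ n ∧ l ∣ n then (1 : ℝ) else 0) := by
          simp only [h1]
          rw [Finset.sum_comm]
          exact Finset.sum_congr rfl fun p _ => Finset.sum_comm
      _ ≤ ∑ p ∈ T, ∑ l ∈ T,
            (x * ((p : ℝ)⁻¹ * (l : ℝ)⁻¹) + if p = l then x * (p : ℝ)⁻¹ else 0) :=
          Finset.sum_le_sum fun p hp => Finset.sum_le_sum fun l hl => h2 p hp l hl
      _ = x * S ^ 2 + x * S := by
          simp only [Finset.sum_add_distrib, Finset.sum_ite_eq, ← Finset.mul_sum]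
          rw [← Finset.sum_mul, ← hS, ← sq]
          congr 1
          rw [hS, Finset.mul_sum]
          exact Finset.sum_congr rfl fun p hp => if_pos hp
  have hvar : ∑ n ∈ Finset.Ioc 0 x, (ω n - S) ^ 2 ≤ 3 * x * S := by
    have h1 : ∑ n ∈ Finset.Ioc 0 x, (ω n - S) ^ 2 =
        ∑ n ∈ Finset.Ioc 0 x, ω n ^ 2 - 2 * S * ∑ n ∈ Finset.Ioc 0 x, ω n + x * S ^ 2 := by
      rw [Finset.mul_sum, ← Finset.sum_sub_distrib,
        show (x : ℝ) * S ^ 2 = ∑ n ∈ Finset.Ioc 0 x, S ^ 2 by simp, ← Finset.sum_add_distrib]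
      exact Finset.sum_congr rfl fun n _ => by ring
    rw [h1]
    have := mul_le_mul_of_nonneg_left hfirst (by positivity : 0 ≤ 2 * S)
    nlinarith
  have hlow : (((Finset.Ioc 0 x).filter fun n => ∀ p ∈ T, ¬ p ∣ n).card : ℝ) * S ^ 2 ≤
      ∑ n ∈ Finset.Ioc 0 x, (ω n - S) ^ 2 := by
    calc _ = ∑ n ∈ (Finset.Ioc 0 x).filter fun n => ∀ p ∈ T, ¬ p ∣ n, (ω n - S) ^ 2 := by
          rw [← nsmul_eq_mul, ← Finset.sum_const]
          refine Finset.sum_congr rfl fun n hn => ?_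
          have : ω n = 0 := Finset.sum_eq_zero fun p hp => if_neg ((Finset.mem_filter.1 hn).2 p hp)
          rw [this]; ring
      _ ≤ _ := Finset.sum_le_sum_of_subset_of_nonneg (Finset.filter_subset _ _)
          fun n _ _ => sq_nonneg _
  have := hlow.trans hvar
  refine le_of_mul_le_mul_right ?_ hSpos
  linarith

open scoped Classical in
/-- Writing `d = 1 + k * j` with `j ≥ 1`, the bound is a sum of `x / k ^ 2` and of
`x / (k * (1 + k * j)) ≤ x / (k ^ 2 * j)` over `k > z` and `1 ≤ j ≤ x`. -/
theorem card_filter_exists_dvd_le (x z : ℕ) (hz : 0 < z) :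
    (((Finset.Ioc 0 x).filter fun n => ∃ k > z, k * k ∣ n ∨
      ∃ d, k * d ∣ n ∧ d ≡ 1 [MOD k] ∧ d ≠ 1).card : ℝ) ≤ x * ((2 + Real.log x) / z) := by
  let B : ℕ → Finset ℕ := fun d => (Finset.Ioc 0 x).filter (d ∣ ·)
  have hsub : ((Finset.Ioc 0 x).filter fun n => ∃ k > z, k * k ∣ n ∨
      ∃ d, k * d ∣ n ∧ d ≡ 1 [MOD k] ∧ d ≠ 1) ⊆
      (Finset.Ioc z x).biUnion fun k =>
        B (k * k) ∪ (Finset.Icc 1 x).biUnion fun j => B (k * (1 + k * j)) := by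
    intro n hn
    obtain ⟨hnx, k, hk, h⟩ := Finset.mem_filter.1 hn
    obtain ⟨hn0, hnx'⟩ := Finset.mem_Ioc.1 hnx
    have hkn : k ∣ n := by
      rcases h with h | ⟨d, h, -⟩
      · exact (dvd_mul_right k k).trans h
      · exact (dvd_mul_right k d).trans h
    refine Finset.mem_biUnion.2
      ⟨k, Finset.mem_Ioc.2 ⟨hk, (Nat.le_of_dvd hn0 hkn).trans hnx'⟩, Finset.mem_union.2 ?_⟩
    refine h.imp (fun h => Finset.mem_filter.2 ⟨hnx, h⟩) ?_
    rintro ⟨d, hd, hmod, hd1⟩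
    have hd0 : 0 < d := Nat.pos_of_ne_zero fun h0 => by
      rw [h0, mul_zero, zero_dvd_iff] at hd; omega
    obtain ⟨j, hj⟩ := (Nat.modEq_iff_dvd' hd0).1 hmod.symm
    have hdj : d = 1 + k * j := by omega
    have hj0 : 1 ≤ j := Nat.one_le_iff_ne_zero.2 fun h0 => hd1 (by rw [hdj, h0, mul_zero, add_zero])
    refine Finset.mem_biUnion.2 ⟨j, Finset.mem_Icc.2 ⟨hj0, ?_⟩,
      Finset.mem_filter.2 ⟨hnx, hdj ▸ hd⟩⟩
    have h1 : d ≤ n := Nat.le_of_dvd hn0 ((dvd_mul_left d k).trans hd)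
    have h2 : j ≤ k * j := Nat.le_mul_of_pos_left j (by omega)
    omega
  have hharm : ∑ j ∈ Finset.Icc 1 x, (j : ℝ)⁻¹ ≤ 1 + Real.log x := by
    have := harmonic_le_one_add_log x
    rw [harmonic_eq_sum_Icc] at this
    push_cast at this
    exact this
  have hB : ∀ d : ℕ, ((B d).card : ℝ) ≤ x / d := Nat.cast_card_filter_dvd_le x
  have hk : ∀ k ∈ Finset.Ioc z x,
      ((B (k * k) ∪ (Finset.Icc 1 x).biUnion fun j => B (k * (1 + k * j))).card : ℝ) ≤
        x * (2 + Real.log x) * ((k : ℝ) ^ 2)⁻¹ := by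
    intro k hk
    have hk0 : (0 : ℝ) < k := by exact_mod_cast hz.trans (Finset.mem_Ioc.1 hk).1
    calc ((B (k * k) ∪ (Finset.Icc 1 x).biUnion fun j => B (k * (1 + k * j))).card : ℝ)
        ≤ (B (k * k)).card + ∑ j ∈ Finset.Icc 1 x, ((B (k * (1 + k * j))).card : ℝ) := by
          exact_mod_cast (Finset.card_union_le _ _).trans
            (Nat.add_le_add_left Finset.card_biUnion_le _)
      _ ≤ x * ((k : ℝ) ^ 2)⁻¹ + ∑ j ∈ Finset.Icc 1 x, x * ((k : ℝ) ^ 2)⁻¹ * (j : ℝ)⁻¹ := by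
          refine add_le_add ((hB _).trans (le_of_eq ?_))
            (Finset.sum_le_sum fun j hj => (hB _).trans ?_)
          · push_cast; rw [div_eq_mul_inv, sq]
          · have hj0 : (0 : ℝ) < j := by exact_mod_cast (Finset.mem_Icc.1 hj).1
            push_cast
            rw [mul_assoc, ← mul_inv, ← div_eq_mul_inv]
            refine div_le_div_of_nonneg_left (by positivity) (by positivity) ?_
            nlinarith
      _ = x * ((k : ℝ) ^ 2)⁻¹ * (1 + ∑ j ∈ Finset.Icc 1 x, (j : ℝ)⁻¹) := by
          rw [← Finset.mul_sum]; ring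
      _ ≤ x * ((k : ℝ) ^ 2)⁻¹ * (1 + (1 + Real.log x)) := by gcongr
      _ = _ := by ring
  have hlog : 0 ≤ Real.log x := Real.log_natCast_nonneg x
  have hsq : ∑ k ∈ Finset.Ioc z x, ((k : ℝ) ^ 2)⁻¹ ≤ (z : ℝ)⁻¹ := by
    rcases le_total z x with h | h
    · have h1 := sum_Ioc_inv_sq_le_sub (α := ℝ) hz.ne' h
      have : (0 : ℝ) ≤ (x : ℝ)⁻¹ := by positivity
      linarith
    · rw [Finset.Ioc_eq_empty_of_le h, Finset.sum_empty]; positivity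
  calc _ ≤ ∑ k ∈ Finset.Ioc z x,
        ((B (k * k) ∪ (Finset.Icc 1 x).biUnion fun j => B (k * (1 + k * j))).card : ℝ) := by
        exact_mod_cast (Finset.card_le_card hsub).trans Finset.card_biUnion_le
    _ ≤ ∑ k ∈ Finset.Ioc z x, x * (2 + Real.log x) * ((k : ℝ) ^ 2)⁻¹ := Finset.sum_le_sum hk
    _ = x * (2 + Real.log x) * ∑ k ∈ Finset.Ioc z x, ((k : ℝ) ^ 2)⁻¹ := by rw [Finset.mul_sum]
    _ ≤ x * (2 + Real.log x) * (z : ℝ)⁻¹ := by gcongr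
    _ = _ := by rw [mul_assoc, div_eq_mul_inv]

/-! ### Density zero -/

theorem eventually_ceil_log_sq_pow_le (m : ℕ) :
    ∀ᶠ x : ℕ in Filter.atTop, ⌈Real.log x ^ 2⌉₊ ^ m ≤ x := by
  have hlog : Filter.Tendsto (fun x : ℕ => Real.log x) Filter.atTop Filter.atTop :=
    Real.tendsto_log_atTop.comp tendsto_natCast_atTop_atTop
  have h1 := (Real.isLittleO_pow_log_id_atTop (n := 3 * m)).comp_tendsto
    tendsto_natCast_atTop_atTop (k := (Nat.cast : ℕ → ℝ))
  filter_upwards [h1.bound one_pos, hlog.eventually_ge_atTop 2] with x hx hx2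
  simp only [Function.comp_apply, id_eq, one_mul, Real.norm_eq_abs, Nat.abs_cast] at hx
  have h2 : (⌈Real.log x ^ 2⌉₊ : ℝ) ≤ Real.log x ^ 3 := by
    have := (Nat.ceil_lt_add_one (by positivity : 0 ≤ Real.log x ^ 2)).le
    nlinarith [sq_nonneg (Real.log x)]
  have h3 : (⌈Real.log x ^ 2⌉₊ : ℝ) ^ m ≤ x := by
    calc (⌈Real.log x ^ 2⌉₊ : ℝ) ^ m ≤ (Real.log x ^ 3) ^ m := by gcongr
      _ = Real.log x ^ (3 * m) := by rw [pow_mul]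
      _ ≤ x := (le_abs_self _).trans hx
  exact_mod_cast h3

/-- A set of integers has density zero if none of its elements `n` has a large prime factor `p` in a
fixed invertible residue class with `p ^ 2 ∤ n` and such that `n / p` has no divisor `d ≠ 1`
congruent to `1` modulo `p`. -/
theorem hasNaturalDensity_zero_of_forall_prime {q : ℕ} [NeZero q] {a : ZMod q} (ha : IsUnit a)
    {Q : Set ℕ} (p₀ : ℕ)
    (hQ : ∀ n ∈ Q, ∀ p : ℕ, p.Prime → p₀ < p → (p : ZMod q) = a → p ∣ n →
      p * p ∣ n ∨ ∃ d, p * d ∣ n ∧ d ≡ 1 [MOD p] ∧ d ≠ 1) :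
    HasNaturalDensity Q 0 := by
  classical
  have hlog : Filter.Tendsto (fun x : ℕ => Real.log x) Filter.atTop Filter.atTop :=
    Real.tendsto_log_atTop.comp tendsto_natCast_atTop_atTop
  have hz : Filter.Tendsto (fun x : ℕ => ⌈Real.log x ^ 2⌉₊) Filter.atTop Filter.atTop :=
    tendsto_nat_ceil_atTop.comp ((Filter.tendsto_pow_atTop two_ne_zero).comp hlog)
  rw [HasNaturalDensity, Metric.tendsto_nhds]
  intro ε hε
  obtain ⟨m, Y₀, hm⟩ := exists_le_sum_inv_primes ha (12 / ε)
  filter_upwards [hz.eventually_ge_atTop (max Y₀ (max p₀ 1)), eventually_ceil_log_sq_pow_le m,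
    hlog.eventually_ge_atTop 2, hlog.eventually_gt_atTop (4 / ε),
    Filter.eventually_gt_atTop 0] with x hzx hpow hlog2 hlogε hx0
  set z := ⌈Real.log x ^ 2⌉₊
  have hx0' : (0 : ℝ) < x := by exact_mod_cast hx0
  have hzY : Y₀ ≤ z := (le_max_left _ _).trans hzx
  have hzp : p₀ ≤ z := (le_max_left _ _).trans ((le_max_right _ _).trans hzx)
  have hz0 : 0 < z := (le_max_right _ _).trans ((le_max_right _ _).trans hzx)
  set T := primesInResidueClass a z x
  have hS : 12 / ε ≤ ∑ p ∈ T, (p : ℝ)⁻¹ := by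
    refine (hm z hzY).trans (Finset.sum_le_sum_of_subset_of_nonneg ?_ fun p _ _ => by positivity)
    exact Finset.filter_subset_filter _ (Finset.Ioc_subset_Ioc_right hpow)
  have hTcard : T.card ≤ x := by
    refine (Finset.card_filter_le _ _).trans ?_
    rw [Nat.card_Ioc]
    exact Nat.sub_le _ _
  have h1 := card_filter_not_dvd_mul_le x T (fun p hp => (Finset.mem_filter.1 hp).2.1) hTcard
  have h2 := card_filter_exists_dvd_le x z hz0
  set A := (Finset.Ioc 0 x).filter fun n => ∀ p ∈ T, ¬ p ∣ n
  set B := (Finset.Ioc 0 x).filter fun n => ∃ k > z, k * k ∣ n ∨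
      ∃ d, k * d ∣ n ∧ d ≡ 1 [MOD k] ∧ d ≠ 1
  have hsub : Q ∩ Set.Icc 1 x ⊆ ((A ∪ B : Finset ℕ) : Set ℕ) := by
    rintro n ⟨hnQ, hn1, hnx⟩
    have hn : n ∈ Finset.Ioc 0 x := Finset.mem_Ioc.2 ⟨hn1, hnx⟩
    rw [Finset.mem_coe, Finset.mem_union]
    by_cases h : ∀ p ∈ T, ¬ p ∣ n
    · exact Or.inl (Finset.mem_filter.2 ⟨hn, h⟩)
    · push Not at h
      obtain ⟨p, hpT, hpn⟩ := h
      obtain ⟨hpI, hp, hpa⟩ := Finset.mem_filter.1 hpT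
      have hzp' := (Finset.mem_Ioc.1 hpI).1
      exact Or.inr (Finset.mem_filter.2
        ⟨hn, p, hzp', hQ n hnQ p hp (hzp.trans_lt hzp') hpa hpn⟩)
  have hncard : ((Q ∩ Set.Icc 1 x).ncard : ℝ) ≤ A.card + B.card := by
    have := Set.ncard_le_ncard hsub (Finset.finite_toSet _)
    rw [Set.ncard_coe_finset] at this
    exact_mod_cast this.trans (Finset.card_union_le _ _)
  have hA : (A.card : ℝ) ≤ x * (ε / 4) := by
    have h3 := (mul_le_mul_of_nonneg_left hS (Nat.cast_nonneg A.card)).trans h1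
    rw [mul_div_assoc', div_le_iff₀ hε] at h3
    linarith
  have hB : (2 + Real.log x) / z ≤ ε / 2 := by
    have hzlog : Real.log x ^ 2 ≤ z := Nat.le_ceil _
    have hz0' : (0 : ℝ) < z := by exact_mod_cast hz0
    rw [div_lt_iff₀ hε] at hlogε
    rw [div_le_iff₀ hz0']
    nlinarith
  have hB' := h2.trans (mul_le_mul_of_nonneg_left hB hx0'.le)
  rw [Real.dist_eq, sub_zero, abs_of_nonneg (by positivity), div_lt_iff₀ hx0']
  have : 0 < ε * x := by positivity
  linarith

theorem theorem1 (r s t : ℕ) (hr : 0 < r) (hs : 0 < s) (ht : 0 < t) :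
    HasNaturalDensity (finiteQuotientOrders (OrdinaryTriangleGroup r s t)) 0 := by
  have : NeZero (r * s) := ⟨(Nat.mul_pos hr hs).ne'⟩
  refine hasNaturalDensity_zero_of_forall_prime (q := r * s) (a := -1) isUnit_one.neg (r + s + t)
    fun n hn p hp hlt hpa hpn => ?_
  have hdvd : r * s ∣ p + 1 := by
    rw [← ZMod.natCast_eq_zero_iff, Nat.cast_add, hpa, Nat.cast_one, neg_add_cancel]
  exact exists_dvd_of_mem_finiteQuotientOrders hr hs ht hn hp (by omega) (by omega) (by omega)
    ((dvd_mul_right r s).trans hdvd) ((dvd_mul_left s r).trans hdvd) hpn
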